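/- **Setting.** A dataset $X=(X_1,\dots,X_n)\in\mathcal Z^n$ consists of $n$ private records. Let $d(X,Y)$ be the number of coordinates in which $X$ and $Y$ differ, and write $X\simeq X'$ (neighbours) if $d(X,X')\le 1$. A randomized algorithm $\mathcal M$ satisfies $(\epsilon,\delta)$-DP if $\Pr[\mathcal M(X)\in S]\le e^{\epsilon}\Pr[\mathcal M(X')\in S]+\delta$ for all $X\simeq X'$ and all measurable $S$. For $\alpha>1$, let $D_\alpha(P\|Q)=\frac{1}{\alpha-1}\log \mathbb E_{o\sim Q}\big[(\tfrac{dP}{dQ}(o))^{\alpha}\big]$ if $P\ll Q$, and $D_\alpha(P\|Q)=\infty$ otherwise. A function $r:\mathcal Z^n\to\mathbb R$ is a *data-dependent RDP function* of order $\alpha$ for $\mathcal M$ if $D_\alpha(\mathcal M(X)\|\mathcal M(X'))\le r(X)$ for all $X\simeq X'$; the smallest one is $r(X)=\sup_{X'\simeq X}D_\alpha(\mathcal M(X)\|\mathcal M(X'))$. For $f:\mathcal Z^n\to\mathbb R$ let $\Delta_{LS}(Y)=\sup_{Y'\simeq Y}|f(Y)-f(Y')|$. The *$\beta$-smooth sensitivity*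 of $f$ is $SS_\beta(X)=\sup_{d\ge 0}e^{-\beta d}\sup_{Y:\,d(X,Y)\le d}\Delta_{LS}(Y)$. More generally, $SS:\mathcal Z^n\to\mathbb R$ is a *$\beta$-smooth sensitivity bound* of $f$ if $|f(X)-f(X')|\le SS(X)$ and $SS(X)\le e^{\beta}SS(X')$ for all $X\simeq X'$. The records are split into $K$ disjoint shards, and teacher $k$ is a classifier into $C\ge 1$ classes trained on shard $k$ only. Let $x_1,\dots,x_T$ be unlabeled public points, and let $n_j(x_i)$ be the number of teachers that predict class $j$ at $x_i$. A (possibly randomized) training procedure turns labels $y_{1:T}$ of $x_{1:T}$ into a student model, and has no other access to the private data. **Algorithm (PATE with generalized PTR).** The parameters are $\sigma_1>0$, $\epsilon'\ge 0$, $\hat\epsilon>0$ and $0<\delta<1$. Put $$\alpha=\frac{2\log(2/\delta)}{\hat\epsilon}+1,\qquad \sigma_s=\sigma_2=\sqrt{\frac{3\alpha+2}{\hat\epsilon}},\qquad \delta_2=\frac{\delta}{2},\qquad \beta=\frac{0.2}{\alpha}.$$ 1. Draw noisy labels $y_i=\operatorname{argmax}_{j\in[C]}\{n_j(x_i)+\mathcal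 N(0,\sigma_1^2)\}$ for $i\in[T]$, with independent noises. 2. Let $\mathrm{RDP}(\alpha,X)$ be the data-dependent RDP of order $\alpha$ of releasing $y_{1:T}$, and let $SS_\beta(X)$ be the $\beta$-smooth sensitivity of $X\mapsto\mathrm{RDP}(\alpha,X)$. 3. With independent noises $z_2\sim\mathcal N(0,\sigma_2^2)$ and $z_s\sim\mathcal N(0,\sigma_s^2)$, which are also independent of the labels and of the training of the student, release $$\mu=\log SS_\beta(X)+\beta z_2+\sqrt{2\log(2/\delta_2)}\,\sigma_2\beta,$$ $$\mathrm{RDP}^{\mathrm{upper}}(\alpha)=\mathrm{RDP}(\alpha,X)+SS_\beta(X)\,z_s+\sigma_s\sqrt{2\log(2/\delta_2)}\;e^{\mu}.$$ In the degenerate case $SS_\beta\equiv 0$, read $\log 0$ as $0$. 4. Convert at $\delta/2$: $\epsilon_{\sigma_1}=\mathrm{RDP}^{\mathrm{upper}}(\alpha)+\frac{\log(2/\delta)}{\alpha-1}$. If $\epsilon_{\sigma_1}\le\epsilon'$, return a student model trained on $(x_{1:T};y_{1:T})$; otherwise return $\perp$. **Theorem.** The algorithm satisfies $(\epsilon'+\hat\epsilon,\delta)$-DP,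 where $\mathrm{RDP}(\alpha,X)$ is the smallest data-dependent RDP function of the noisy labels and $SS_\beta$ is its $\beta$-smooth sensitivity. The same holds if $\mathrm{RDP}(\alpha,\cdot)$ is replaced by any data-dependent RDP function of order $\alpha$ for the noisy labels, and $SS_\beta$ by any $\beta$-smooth sensitivity bound of that function. In both cases the guarantee holds for the returned value (a student model or $\perp$), and also for the joint release of $\mu$, $\mathrm{RDP}^{\mathrm{upper}}(\alpha)$ and the returned value. -/

import Mathlib

open MeasureTheory ProbabilityTheory
open scoped ENNReal NNReal

/-! ### Datasets, randomized algorithms, privacy notions -/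

open Classical in
/-- Number of coordinates in which two datasets of the same size `n` differ. -/
noncomputable def recordDist {Z : Type*} {n : ℕ} (X Y : Fin n → Z) : ℕ :=
  hammingDist X Y

/-- Neighbouring datasets: they differ in at most one record. -/
def Neighbor {Z : Type*} {n : ℕ} (X Y : Fin n → Z) : Prop :=
  recordDist X Y ≤ 1

/-- A randomized algorithm is given by its output laws `M X`, one for each dataset `X`.
It is `(ε, δ)`-differentially private if for all neighbouring `X ≃ X'` and measurable `S`,
`Pr[M X ∈ S] ≤ e^ε Pr[M X' ∈ S] + δ`. -/
def IsDP {Z S : Type*} [MeasurableSpace S] {n : ℕ}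
    (M : (Fin n → Z) → Measure S) (ε δ : ℝ) : Prop :=
  ∀ X X' : Fin n → Z, Neighbor X X' → ∀ A : Set S, MeasurableSet A →
    M X A ≤ ENNReal.ofReal (Real.exp ε) * M X' A + ENNReal.ofReal δ

/-- The Rényi divergence of order `α > 1`,
`D_α(P ‖ Q) = (α - 1)⁻¹ log E_{o ∼ Q} [(dP/dQ)(o) ^ α]`, and `⊤` unless `P ≪ Q`. -/
noncomputable def renyiDiv {S : Type*} [MeasurableSpace S] (α : ℝ) (P Q : Measure S) : EReal :=
  open Classical in
  if P ≪ Q then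
    (((α - 1)⁻¹ : ℝ) : EReal) * ENNReal.log (∫⁻ o, (P.rnDeriv Q o) ^ α ∂Q)
  else ⊤

/-- `rdp` is a data-dependent RDP function of order `α` for `M`: for every dataset `X`, the
algorithm `M` is `(α, rdp X)`-RDP for the dataset `X`. -/
def IsDataDependentRDP {Z S : Type*} [MeasurableSpace S] {n : ℕ}
    (M : (Fin n → Z) → Measure S) (α : ℝ) (rdp : (Fin n → Z) → ℝ) : Prop :=
  ∀ X X' : Fin n → Z, Neighbor X X' → renyiDiv α (M X) (M X') ≤ (rdp X : EReal)

/-- The smallest data-dependent RDP function: the largest Rényi divergence of order `α` of `M X`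
from `M X'`, over all neighbours `X'` of `X`. -/
noncomputable def optimalRDP {Z S : Type*} [MeasurableSpace S] {n : ℕ}
    (M : (Fin n → Z) → Measure S) (α : ℝ) (X : Fin n → Z) : ℝ :=
  (⨆ (X' : Fin n → Z) (_ : Neighbor X X'), renyiDiv α (M X) (M X')).toReal

/-! ### Smooth sensitivity -/

/-- Local sensitivity of a real-valued function on datasets. -/
noncomputable def localSensitivity {Z : Type*} {n : ℕ} (f : (Fin n → Z) → ℝ)
    (X : Fin n → Z) : ℝ≥0∞ :=
  ⨆ (X' : Fin n → Z) (_ : Neighbor X X'), ENNReal.ofReal |f X - f X'|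

/-- The `β`-smooth sensitivity `max_{d ≥ 0} e^{-β d} max_{Y : dist(X, Y) ≤ d} Δ_LS(Y)`. -/
noncomputable def smoothSensitivity {Z : Type*} {n : ℕ} (β : ℝ) (f : (Fin n → Z) → ℝ)
    (X : Fin n → Z) : ℝ≥0∞ :=
  ⨆ d : ℕ, ENNReal.ofReal (Real.exp (-(β * d))) *
    ⨆ (Y : Fin n → Z) (_ : recordDist X Y ≤ d), localSensitivity f Y

/-- `SS` is a `β`-smooth sensitivity bound of `f`: it bounds the local sensitivity of `f`, and it
changes by a factor of at most `e^β` between neighbouring datasets. -/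
def IsSmoothSensitivityBound {Z : Type*} {n : ℕ} (β : ℝ) (f SS : (Fin n → Z) → ℝ) : Prop :=
  (∀ X X' : Fin n → Z, Neighbor X X' → |f X - f X'| ≤ SS X) ∧
  ∀ X X' : Fin n → Z, Neighbor X X' → SS X ≤ Real.exp β * SS X'

/-! ### The PATE set-up and its noisy labels -/

/-- The PATE set-up. The `n` private records are split into `K` disjoint shards; teacher `k` is a
classifier into `C` classes, trained on the records of shard `k` only. There are `T` unlabeled
public points, and a (possibly randomized) training procedure for the student model, with values in
the model space `Θ`, which only sees the public points and their labels. -/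
structure PATE (Z U Θ : Type*) [MeasurableSpace Θ] (n K T C : ℕ) where
  /-- the shard to which a record belongs -/
  shard : Fin n → Fin K
  /-- training of teacher `k` on its shard -/
  teacher : (k : Fin K) → ({i : Fin n // shard i = k} → Z) → U → Fin C
  /-- the unlabeled public data -/
  query : Fin T → U
  /-- law of the student model trained on labeled public data -/
  student : (Fin T → U × Fin C) → ProbabilityMeasure Θ

/-- Plurality label; ties are broken in favour of the smallest label. -/
noncomputable def argmaxLabel {C : ℕ} [NeZero C] (v : Fin C → ℝ) : Fin C :=
  (Finset.univ.filter fun j => ∀ k, v k ≤ v j).min' <| by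
    obtain ⟨j, hj⟩ := Finite.exists_max v
    exact ⟨j, by simpa using hj⟩

/-- The centred normal law `N(0, σ²)`. -/
noncomputable abbrev normalNoise (σ : ℝ) : Measure ℝ :=
  gaussianReal 0 (Real.toNNReal (σ ^ 2))

namespace PATE

variable {Z U Θ : Type*} [MeasurableSpace Θ] {n K T C : ℕ}

/-- The vote count `n_j(x)`: the number of teachers that predict label `j` at the point `x`. -/
def votes (P : PATE Z U Θ n K T C) (X : Fin n → Z) (x : U) (j : Fin C) : ℕ :=
  (Finset.univ.filter fun k : Fin K => P.teacher k (fun i => X i) x = j).card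

/-- Law of the noisy labels `y_i = argmax_j (n_j(x_i) + N(0, σ₁²))`, `i = 1, …, T`, with
independent noise for every query `i` and every label `j`. -/
noncomputable def noisyLabels [NeZero C] (P : PATE Z U Θ n K T C) (σ₁ : ℝ) (X : Fin n → Z) :
    Measure (Fin T → Fin C) :=
  (Measure.pi fun _ : Fin T => Measure.pi fun _ : Fin C => normalNoise σ₁).map
    fun g i => argmaxLabel fun j => (P.votes X (P.query i) j : ℝ) + g i j

/-- Law of the student model trained on the noisily labeled public data. -/
noncomputable def studentModel [NeZero C] (P : PATE Z U Θ n K T C) (σ₁ : ℝ) (X : Fin n → Z) :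
    Measure Θ :=
  (P.noisyLabels σ₁ X).bind fun y => (P.student fun i => (P.query i, y i) : Measure Θ)

end PATE

/-! ### Parameters of the algorithm and its private test -/

/-- The RDP order `α = 2 log(2/δ) / ε̂ + 1`. -/
noncomputable def ptrOrder (εhat δ : ℝ) : ℝ := 2 * Real.log (2 / δ) / εhat + 1

/-- The noise level `σ_s = σ₂ = √((3α + 2) / ε̂)`. -/
noncomputable def ptrSigma (εhat δ : ℝ) : ℝ := √((3 * ptrOrder εhat δ + 2) / εhat)

/-- The smoothness parameter `β = 0.2 / α`. -/
noncomputable def ptrBeta (εhat δ : ℝ) : ℝ := (1 / 5) / ptrOrder εhat δ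

/-- `μ = log SS + β z₂ + √(2 log(2/δ₂)) σ₂ β` with `δ₂ = δ/2`, where `z₂` is a sample of
`N(0, σ₂²)` and `ss` is the value of the smooth sensitivity. -/
noncomputable def ptrMu (εhat δ ss z₂ : ℝ) : ℝ :=
  Real.log ss + ptrBeta εhat δ * z₂
    + √(2 * Real.log (2 / (δ / 2))) * ptrSigma εhat δ * ptrBeta εhat δ

/-- `RDP^upper = RDP(α, X) + SS z_s + σ_s √(2 log(2/δ₂)) e^μ` with `δ₂ = δ/2`, where `z_s` is a
sample of `N(0, σ_s²)`, and `r`, `ss` are the values of the RDP function and of the smooth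
sensitivity. -/
noncomputable def ptrUpper (εhat δ r ss z₂ zs : ℝ) : ℝ :=
  r + ss * zs
    + ptrSigma εhat δ * √(2 * Real.log (2 / (δ / 2))) * Real.exp (ptrMu εhat δ ss z₂)

/-- Conversion of an `(α, r)`-RDP guarantee into an `(ε, δ₀)`-DP guarantee:
`ε = r + log(1/δ₀) / (α - 1)`. -/
noncomputable def rdpToDP (α δ₀ r : ℝ) : ℝ := r + Real.log (1 / δ₀) / (α - 1)

/-- Joint law of the two privately released numbers `(μ, RDP^upper)`; the noises `z₂ ∼ N(0, σ₂²)`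
and `z_s ∼ N(0, σ_s²)` are independent. -/
noncomputable def ptrTest (εhat δ r ss : ℝ) : Measure (ℝ × ℝ) :=
  ((normalNoise (ptrSigma εhat δ)).prod (normalNoise (ptrSigma εhat δ))).map
    fun z => (ptrMu εhat δ ss z.1, ptrUpper εhat δ r ss z.1 z.2)

open Classical in
/-- Given the two released numbers and the student model, what the algorithm releases in total:
`μ`, `RDP^upper`, and the returned value, which is the model (`Sum.inl`) if the DP guarantee that
`RDP^upper` converts to at `δ/2` is at most `ε'`, and `⊥` (`Sum.inr ()`) otherwise. -/
noncomputable def ptrRelease {Θ : Type*} (ε' εhat δ : ℝ) (w : (ℝ × ℝ) × Θ) :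
    ℝ × ℝ × (Θ ⊕ Unit) :=
  (w.1.1, w.1.2,
    if rdpToDP (ptrOrder εhat δ) (δ / 2) w.1.2 ≤ ε' then Sum.inl w.2 else Sum.inr ())

namespace PATE

variable {Z U Θ : Type*} [MeasurableSpace Θ] {n K T C : ℕ}

/-- PATE with generalized PTR, run with the data-dependent RDP function `rdp` and the smooth
sensitivity `SS`: law of everything that is released, namely `μ`, `RDP^upper` and the returned
value. The noises of the test are independent of the noisy labels and of the training of the
student. -/
noncomputable def ptrTranscript [NeZero C] (P : PATE Z U Θ n K T C) (σ₁ ε' εhat δ : ℝ)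
    (rdp SS : (Fin n → Z) → ℝ) (X : Fin n → Z) : Measure (ℝ × ℝ × (Θ ⊕ Unit)) :=
  ((ptrTest εhat δ (rdp X) (SS X)).prod (P.studentModel σ₁ X)).map (ptrRelease ε' εhat δ)

/-- PATE with generalized PTR: law of the returned value, a student model or `⊥`. -/
noncomputable def ptr [NeZero C] (P : PATE Z U Θ n K T C) (σ₁ ε' εhat δ : ℝ)
    (rdp SS : (Fin n → Z) → ℝ) (X : Fin n → Z) : Measure (Θ ⊕ Unit) :=
  (P.ptrTranscript σ₁ ε' εhat δ rdp SS X).map fun w => w.2.2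

/-- The data-dependent RDP, at the order `α` of the algorithm, of releasing all noisy labels. -/
noncomputable def labelRDP [NeZero C] (P : PATE Z U Θ n K T C) (σ₁ εhat δ : ℝ)
    (X : Fin n → Z) : ℝ :=
  optimalRDP (P.noisyLabels σ₁) (ptrOrder εhat δ) X

/-- The `β`-smooth sensitivity of the data-dependent RDP of the noisy labels. -/
noncomputable def labelSS [NeZero C] (P : PATE Z U Θ n K T C) (σ₁ εhat δ : ℝ)
    (X : Fin n → Z) : ℝ :=
  (smoothSensitivity (ptrBeta εhat δ) (P.labelRDP σ₁ εhat δ) X).toReal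

end PATE

/-! ### The laws above are probability measures -/

theorem measurable_argmaxLabel {C : ℕ} [NeZero C] :
    Measurable (argmaxLabel : (Fin C → ℝ) → Fin C) := by
  have key : ∀ (v : Fin C → ℝ) (j : Fin C), argmaxLabel v = j ↔
      (∀ k, v k ≤ v j) ∧ ∀ i, (∀ k, v k ≤ v i) → j ≤ i := by
    intro v j
    unfold argmaxLabel
    rw [Finset.min'_eq_iff]
    simp
  refine measurable_to_countable' fun j => ?_
  have : argmaxLabel ⁻¹' {j} = {v : Fin C → ℝ |
      (∀ k, v k ≤ v j) ∧ ∀ i, (∀ k, v k ≤ v i) → j ≤ i} := by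
    ext v; simp [key]
  rw [this]
  measurability

theorem measurable_ptrRelease {Θ : Type*} [MeasurableSpace Θ] (ε' εhat δ : ℝ) :
    Measurable (ptrRelease (Θ := Θ) ε' εhat δ) := by
  unfold ptrRelease rdpToDP
  refine Measurable.prodMk (by fun_prop) (Measurable.prodMk (by fun_prop) ?_)
  refine Measurable.ite (measurableSet_le (by fun_prop) (by fun_prop)) ?_ measurable_const
  exact measurable_inl.comp measurable_snd

namespace PATE

variable {Z U Θ : Type*} [MeasurableSpace Θ] {n K T C : ℕ}

instance [NeZero C] (P : PATE Z U Θ n K T C) (σ₁ : ℝ) (X : Fin n → Z) :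
    IsProbabilityMeasure (P.noisyLabels σ₁ X) := by
  refine Measure.isProbabilityMeasure_map (Measurable.aemeasurable ?_)
  refine measurable_pi_lambda _ fun i => measurable_argmaxLabel.comp ?_
  fun_prop

instance [NeZero C] (P : PATE Z U Θ n K T C) (σ₁ : ℝ) (X : Fin n → Z) :
    IsProbabilityMeasure (P.studentModel σ₁ X) := by
  refine isProbabilityMeasure_bind (Measurable.of_discrete.aemeasurable) ?_
  exact Filter.Eventually.of_forall fun y => inferInstance

instance [NeZero C] (P : PATE Z U Θ n K T C) (σ₁ ε' εhat δ : ℝ)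
    (rdp SS : (Fin n → Z) → ℝ) (X : Fin n → Z) :
    IsProbabilityMeasure (P.ptrTranscript σ₁ ε' εhat δ rdp SS X) := by
  have : IsProbabilityMeasure (ptrTest εhat δ (rdp X) (SS X)) := by
    refine Measure.isProbabilityMeasure_map (Measurable.aemeasurable ?_)
    unfold ptrUpper ptrMu
    fun_prop
  exact Measure.isProbabilityMeasure_map (measurable_ptrRelease _ _ _).aemeasurable

instance [NeZero C] (P : PATE Z U Θ n K T C) (σ₁ ε' εhat δ : ℝ)
    (rdp SS : (Fin n → Z) → ℝ) (X : Fin n → Z) :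
    IsProbabilityMeasure (P.ptr σ₁ ε' εhat δ rdp SS X) :=
  Measure.isProbabilityMeasure_map (by fun_prop)

end PATE

/-! ### Density form of Rényi differential privacy -/

/-! The order `α` is chosen so that `(α - 1) * (εhat / 2) = log (2 / δ)`. Hence a Rényi bound `b`
gives `b + εhat / 2` in approximate differential privacy, at the cost of an additive `δ / 2`. Two
facts about the private test carry the proof: releasing `(μ, RDP^upper)` costs only `εhat / 2` in
Rényi divergence (`renyiBound_ptrTest`), and `RDP^upper` falls below the true value with probability
at most `δ / 2` (`ptrTest_upper_lt_le`).

Fix neighbours `X`, `X'`. If `rdp X + εhat / 2 ≤ ε'`, the test and the labels together have Rényi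
bound `rdp X + εhat / 2 ≤ ε'`, and conversion finishes. Otherwise the test passes at `X` only if it
underestimates `rdp X`; outside this event of mass `δ / 2` the release is a function of the test
alone, which is `(εhat, δ / 2)`-private. Only the value of `rdp` at `X` decides the case.

For the cost of the test, undo the shift by a multiple of `e^μ`: what remains is a pair of
independent normal variables. The first has a mean shift of at most `β` at noise `βσ`. The second
has a mean shift of at most `s'`, but also standard deviations `sσ` and `s'σ` that differ by a
factor of at most `e^β`; the choice `β = 0.2 / α` keeps the divergence finite and the effect of this
mismatch small. The costs are `α / (2σ²)` and `(α + 1) / σ²`, which add up to `εhat / 2`.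

For the literal algorithm it remains to see that the suprema are finite. This holds because the
label law depends on finitely many vote counts and charges every label vector. -/

/-- `P` has a density with respect to `Q` whose `α`-th moment is at most `exp ((α - 1) * b)`,
so that the Rényi divergence of order `α` of `P` from `Q` is at most `b`. -/
def RenyiBound {S : Type*} [MeasurableSpace S] (α : ℝ) (P Q : Measure S) (b : ℝ) : Prop :=
  ∃ g : S → ℝ≥0∞, Measurable g ∧ P = Q.withDensity g ∧
    ∫⁻ x, g x ^ α ∂Q ≤ ENNReal.ofReal (Real.exp ((α - 1) * b))

namespace RenyiBound

variable {S S' : Type*} [MeasurableSpace S] [MeasurableSpace S'] {α b b' : ℝ}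

theorem refl (Q : Measure S) [IsProbabilityMeasure Q] : RenyiBound α Q Q 0 :=
  ⟨fun _ => 1, measurable_const, by simp, by simp⟩

theorem mono {P Q : Measure S} (hα : 1 ≤ α) (h : RenyiBound α P Q b) (hb : b ≤ b') :
    RenyiBound α P Q b' := by
  obtain ⟨g, hg, hP, hI⟩ := h
  refine ⟨g, hg, hP, hI.trans (ENNReal.ofReal_le_ofReal (Real.exp_le_exp.2 ?_))⟩
  exact mul_le_mul_of_nonneg_left hb (by linarith)

theorem prod {P Q : Measure S} {P' Q' : Measure S'} [SFinite Q'] (hα : 0 ≤ α)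
    (h : RenyiBound α P Q b) (h' : RenyiBound α P' Q' b') :
    RenyiBound α (P.prod P') (Q.prod Q') (b + b') := by
  obtain ⟨g, hg, hP, hI⟩ := h
  obtain ⟨g', hg', hP', hI'⟩ := h'
  refine ⟨fun z => g z.1 * g' z.2, by fun_prop, ?_, ?_⟩
  · rw [hP, hP', prod_withDensity hg hg']
  · simp_rw [ENNReal.mul_rpow_of_nonneg _ _ hα]
    rw [lintegral_prod_mul (f := fun x => g x ^ α) (g := fun y => g' y ^ α) (by fun_prop)
      (by fun_prop), mul_add, Real.exp_add,
      ENNReal.ofReal_mul (Real.exp_nonneg _)]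
    exact mul_le_mul' hI hI'

/-- The left inverse lets the density be transported as `g ∘ ψ`. Invertible post-processing is all
that is needed, so no data-processing inequality enters. -/
theorem map {P Q : Measure S} (h : RenyiBound α P Q b) {φ : S → S'} {ψ : S' → S}
    (hφ : Measurable φ) (hψ : Measurable ψ) (hψφ : Function.LeftInverse ψ φ) :
    RenyiBound α (P.map φ) (Q.map φ) b := by
  obtain ⟨g, hg, hP, hI⟩ := h
  refine ⟨g ∘ ψ, hg.comp hψ, ?_, ?_⟩
  · ext A hA
    rw [Measure.map_apply hφ hA, withDensity_apply _ hA, hP, withDensity_apply _ (hφ hA),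
      setLIntegral_map hA (hg.comp hψ) hφ]
    simp [hψφ _]
  · rw [lintegral_map (by fun_prop) hφ]
    simpa [hψφ _] using hI

/-- Conversion of a Rényi bound into approximate differential privacy, for bounded tests. -/
theorem lintegral_le {P Q : Measure S} (hα : 1 < α) (h : RenyiBound α P Q b) (ε : ℝ)
    {f : S → ℝ≥0∞} (hf : Measurable f) (hf1 : ∀ x, f x ≤ 1) :
    ∫⁻ x, f x ∂P ≤ ENNReal.ofReal (Real.exp ε) * ∫⁻ x, f x ∂Q
      + ENNReal.ofReal (Real.exp ((α - 1) * (b - ε))) := by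
  obtain ⟨g, hg, rfl, hI⟩ := h
  set κ := ENNReal.ofReal (Real.exp ε)
  set c := ENNReal.ofReal (Real.exp (-((α - 1) * ε)))
  have hc : c = κ ^ (-(α - 1)) := by
    simp only [c, κ]
    rw [ENNReal.ofReal_rpow_of_pos (Real.exp_pos _), ← Real.exp_mul]
    ring_nf
  have hκ0 : κ ≠ 0 := by simpa [κ] using Real.exp_pos ε
  have hκt : κ ≠ ∞ := ENNReal.ofReal_ne_top
  -- Above the threshold `κ` the factor `(x / κ) ^ (α - 1)` is at least `1`.
  have key : ∀ x : ℝ≥0∞, x ≤ κ + c * x ^ α := by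
    intro x
    rcases le_total x κ with hx | hx
    · exact hx.trans le_self_add
    · refine le_add_left ?_
      calc x = κ ^ (-(α - 1)) * κ ^ (α - 1) * x := by
            rw [← ENNReal.rpow_add _ _ hκ0 hκt]; simp
        _ ≤ κ ^ (-(α - 1)) * x ^ (α - 1) * x := by
            gcongr
        _ = c * x ^ α := by
            rw [hc, mul_assoc]
            congr 1
            nth_rewrite 2 [← ENNReal.rpow_one x]
            rw [← ENNReal.rpow_add_of_nonneg _ _ (by linarith) zero_le_one, sub_add_cancel]
  rw [lintegral_withDensity_eq_lintegral_mul _ hg hf]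
  calc ∫⁻ x, (g * f) x ∂Q ≤ ∫⁻ x, (κ * f x + c * g x ^ α) ∂Q := by
        refine lintegral_mono fun x => ?_
        calc g x * f x ≤ (κ + c * g x ^ α) * f x := by gcongr; exact key _
          _ = κ * f x + c * g x ^ α * f x := by ring
          _ ≤ κ * f x + c * g x ^ α * 1 := by gcongr; exact hf1 x
          _ = _ := by rw [mul_one]
    _ = κ * ∫⁻ x, f x ∂Q + c * ∫⁻ x, g x ^ α ∂Q := by
        rw [lintegral_add_left (by fun_prop), lintegral_const_mul _ hf,
          lintegral_const_mul _ (by fun_prop)]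
    _ ≤ _ := by
        gcongr
        calc c * ∫⁻ x, g x ^ α ∂Q ≤ c * ENNReal.ofReal (Real.exp ((α - 1) * b)) := by gcongr
          _ = _ := by
            simp only [c]
            rw [← ENNReal.ofReal_mul (Real.exp_nonneg _), ← Real.exp_add]
            ring_nf

theorem of_renyiDiv_le {P Q : Measure S} [SigmaFinite P] [SigmaFinite Q] (hα : 1 < α)
    (h : renyiDiv α P Q ≤ (b : EReal)) : RenyiBound α P Q b := by
  unfold renyiDiv at h
  split_ifs at h with hPQ
  · refine ⟨P.rnDeriv Q, Measure.measurable_rnDeriv _ _,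
      (Measure.withDensity_rnDeriv_eq P Q hPQ).symm, ?_⟩
    have hpos : 0 < (α - 1)⁻¹ := inv_pos.2 (by linarith)
    rw [← ENNReal.log_le_log_iff, ENNReal.log_ofReal_of_pos (Real.exp_pos _), Real.log_exp]
    generalize ENNReal.log _ = l at h
    induction l using EReal.rec with
    | bot => exact bot_le
    | top => simp [EReal.coe_mul_top_of_pos hpos] at h
    | coe l =>
      rw [← EReal.coe_mul] at h
      have h1 := EReal.coe_le_coe_iff.1 h
      rw [inv_mul_le_iff₀ (by linarith)] at h1
      exact EReal.coe_le_coe_iff.2 h1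
  · simp at h

end RenyiBound

/-! ### Normal laws: tail and Rényi divergence -/

/-- Lower tail of the centred normal law. -/
theorem normalNoise_Iic_le {σ : ℝ} (hσ : 0 < σ) (t : ℝ) (ht : 0 ≤ t) :
    normalNoise σ (Set.Iic (-(t * σ))) ≤ ENNReal.ofReal (Real.exp (-t ^ 2 / 2)) := by
  -- Chernoff bound at the optimal exponent `-(t / σ)`.
  have h := ProbabilityTheory.measure_le_le_exp_mul_mgf (μ := normalNoise σ) (X := id)
    (t := -(t / σ)) (-(t * σ)) (by simp; positivity) (integrable_exp_mul_gaussianReal _)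
  rw [mgf_id_gaussianReal, ← Real.exp_add] at h
  rw [← ENNReal.ofReal_toReal (measure_ne_top (normalNoise σ) _)]
  refine ENNReal.ofReal_le_ofReal (h.trans_eq ?_)
  congr 1
  rw [Real.coe_toNNReal _ (sq_nonneg σ)]
  field_simp
  ring

/-- Rényi bound between two normal laws. -/
theorem renyiBound_gaussianReal {α m m' b : ℝ} {v w : ℝ≥0} (hv : 0 < v) (hw : 0 < w)
    (hW : 0 < α * w - (α - 1) * v)
    (hb : (α - 1) / 2 * Real.log (w / v) + Real.log (w / (α * w - (α - 1) * v)) / 2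
      + α * (α - 1) * (m - m') ^ 2 / (2 * (α * w - (α - 1) * v)) ≤ (α - 1) * b) :
    RenyiBound α (gaussianReal m v) (gaussianReal m' w) b := by
  have hv' : (0 : ℝ) < v := hv
  have hw' : (0 : ℝ) < w := hw
  have pdf : ∀ (m : ℝ) {v : ℝ≥0}, 0 < v → gaussianPDF m v = fun x => ENNReal.ofReal
      (Real.exp (-(Real.log (2 * Real.pi) + Real.log v) / 2 - (x - m) ^ 2 / (2 * v))) := by
    intro m v hv
    have hv' : (0 : ℝ) < v := hv
    rw [gaussianPDF_def]
    funext x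
    rw [gaussianPDFReal_def]
    congr 1
    rw [sub_eq_add_neg, Real.exp_add, neg_div, Real.exp_neg, ← Real.log_mul (by positivity)
      hv'.ne', ← Real.log_sqrt (by positivity), Real.exp_log (by positivity), ← neg_div]
  set q : ℝ → ℝ := fun x => -(Real.log (2 * Real.pi) + Real.log w) / 2 - (x - m') ^ 2 / (2 * w)
  set d : ℝ → ℝ := fun x => (Real.log w - Real.log v) / 2 + (x - m') ^ 2 / (2 * w)
    - (x - m) ^ 2 / (2 * v)
  have hqm : Measurable fun x => ENNReal.ofReal (Real.exp (q x)) := by simp only [q]; fun_prop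
  have hdm : Measurable fun x => ENNReal.ofReal (Real.exp (d x)) := by simp only [d]; fun_prop
  rw [gaussianReal_of_var_ne_zero m hv.ne', gaussianReal_of_var_ne_zero m' hw.ne', pdf m hv,
    pdf m' hw]
  refine ⟨fun x => ENNReal.ofReal (Real.exp (d x)), hdm, ?_, ?_⟩
  · rw [← withDensity_mul _ hqm hdm]
    congr 1
    funext x
    simp only [Pi.mul_apply]
    rw [← ENNReal.ofReal_mul (Real.exp_nonneg _), ← Real.exp_add]
    simp only [q, d]
    ring_nf
  · rw [lintegral_withDensity_eq_lintegral_mul _ hqm (by fun_prop)]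
    obtain ⟨W, hWdef⟩ : ∃ W : ℝ, W = α * w - (α - 1) * v := ⟨_, rfl⟩
    rw [← hWdef] at hW hb
    set u : ℝ≥0 := ⟨v * w / W, by positivity⟩
    have hu : 0 < u := by
      have : 0 < v * w / W := by positivity
      exact this
    have hu' : (u : ℝ) = v * w / W := rfl
    obtain ⟨c, hc⟩ : ∃ c : ℝ, c = (α * m * w - (α - 1) * m' * v) / W := ⟨_, rfl⟩
    set D := (α - 1) / 2 * Real.log (w / v) + Real.log (w / W) / 2
      + α * (α - 1) * (m - m') ^ 2 / (2 * W) with hD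
    -- Completing the square: `W > 0` makes the integrand `e^D` times a normal density with mean `c`
    -- and variance `v * w / W`.
    have key : ∀ x, q x + d x * α = D +
        (-(Real.log (2 * Real.pi) + Real.log u) / 2 - (x - c) ^ 2 / (2 * u)) := by
      intro x
      have hlog : Real.log (v * w / W) = Real.log v + Real.log w - Real.log W := by
        rw [Real.log_div (by positivity) hW.ne', Real.log_mul hv'.ne' hw'.ne']
      rw [hD, hu', hlog, Real.log_div hw'.ne' hv'.ne', Real.log_div hw'.ne' hW.ne']
      have : α * (α - 1) * (m - m') ^ 2 / (2 * W) - (x - c) ^ 2 / (2 * (v * w / W))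
          = (α - 1) * (x - m') ^ 2 / (2 * w) - α * (x - m) ^ 2 / (2 * v) := by
        rw [hc]
        field_simp
        rw [hWdef]
        ring
      simp only [q, d]
      linear_combination -this
    calc _ = ∫⁻ x, ENNReal.ofReal (Real.exp D) * gaussianPDF c u x := by
          refine lintegral_congr fun x => ?_
          rw [pdf c hu]
          simp only [Pi.mul_apply]
          rw [ENNReal.ofReal_rpow_of_pos (Real.exp_pos _), ← Real.exp_mul,
            ← ENNReal.ofReal_mul (Real.exp_nonneg _), ← Real.exp_add, key,
            ← ENNReal.ofReal_mul (Real.exp_nonneg _), ← Real.exp_add]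
      _ = ENNReal.ofReal (Real.exp D) := by
          rw [lintegral_const_mul _ (measurable_gaussianPDF _ _),
            lintegral_gaussianPDF_eq_one _ hu.ne', mul_one]
      _ ≤ _ := ENNReal.ofReal_le_ofReal (Real.exp_le_exp.2 hb)

/-! ### The private test -/

theorem one_lt_ptrOrder {εhat δ : ℝ} (hεhat : 0 < εhat) (hδ : 0 < δ) (hδ1 : δ < 1) :
    1 < ptrOrder εhat δ := by
  have : 0 < Real.log (2 / δ) := Real.log_pos (by rw [lt_div_iff₀ hδ]; linarith)
  unfold ptrOrder
  have : 0 < 2 * Real.log (2 / δ) / εhat := by positivity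
  linarith

theorem ptrOrder_sub_one_mul {εhat δ : ℝ} (hεhat : 0 < εhat) :
    (ptrOrder εhat δ - 1) * εhat = 2 * Real.log (2 / δ) := by
  unfold ptrOrder
  field_simp
  ring

theorem ptrSigma_pos {εhat δ : ℝ} (hεhat : 0 < εhat) (hα : 1 < ptrOrder εhat δ) :
    0 < ptrSigma εhat δ := by
  unfold ptrSigma
  have : 0 < 3 * ptrOrder εhat δ + 2 := by linarith
  positivity

theorem ptrSigma_sq {εhat δ : ℝ} (hεhat : 0 < εhat) (hα : 1 < ptrOrder εhat δ) :
    ptrSigma εhat δ ^ 2 = (3 * ptrOrder εhat δ + 2) / εhat := by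
  unfold ptrSigma
  have : 0 < 3 * ptrOrder εhat δ + 2 := by linarith
  rw [Real.sq_sqrt (by positivity)]

/-- Taylor expansion of order three: `36 / 250` is the sum of the bounds `2 / 25` for `y² / 2`, `8 /
375` for `y³ / 3` and `(2/5)⁴ / (3/5)` for the remainder. -/
theorem neg_log_one_sub_le {y : ℝ} (hy : |y| ≤ 2 / 5) : -Real.log (1 - y) ≤ y + 36 / 250 := by
  have h := Real.abs_log_sub_add_sum_range_le (x := y) (by linarith) 3
  have h1 : |y| ^ (3 + 1) / (1 - |y|) ≤ (2 / 5) ^ 4 / (3 / 5) := by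
    gcongr
    linarith
  have h2 := (abs_le.1 (h.trans h1)).1
  simp only [Finset.sum_range_succ, Finset.sum_range_zero] at h2
  norm_num at h2
  have hy2 : y ^ 2 ≤ 4 / 25 := by
    have := sq_le_sq' (by linarith [neg_abs_le y]) ((le_abs_self y).trans hy)
    norm_num at this ⊢; linarith
  have hy3 : y ^ 3 ≤ 8 / 125 := by
    have : y ^ 3 ≤ |y| ^ 3 := by rw [← abs_pow]; exact le_abs_self _
    have h3 : |y| ^ 3 ≤ (2 / 5) ^ 3 := by gcongr
    norm_num at h3; linarith
  linarith

/-- Lower bound for the relative variance of the interpolating normal law, and upper bound for the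
contribution of the mismatch of variances to the Rényi divergence. -/
theorem variance_mismatch_le {a u l : ℝ} (ha : 1 < a) (hu : |u| ≤ 2 / (5 * a))
    (hl : Real.log 2 ≤ l) :
    3 / 5 ≤ a - (a - 1) * Real.exp u ∧
      -((a - 1) * u) - Real.log (a - (a - 1) * Real.exp u)
        ≤ 2 * l / (3 * a + 2) * (a / 3 + 2) := by
  have ha0 : 0 < a := by linarith
  have hu1 : 2 / (5 * a) < 1 := by rw [div_lt_one (by positivity)]; linarith
  have hua : |u| * a ≤ 2 / 5 := by
    rw [le_div_iff₀ (by positivity)] at hu; linarith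
  set y := (a - 1) * (Real.exp u - 1) with hy
  have hV : a - (a - 1) * Real.exp u = 1 - y := by rw [hy]; ring
  have hylow : -(2 / 5) ≤ y := by
    have h1 : u ≤ Real.exp u - 1 := by linarith [Real.add_one_le_exp u]
    have h2 : -|u| ≤ Real.exp u - 1 := (neg_abs_le u).trans h1
    nlinarith [abs_nonneg u]
  have hyup : y ≤ 2 / 5 := by
    have h0 := Real.add_one_le_exp (-|u|)
    have h1 : Real.exp |u| * (1 - |u|) ≤ 1 := by
      calc Real.exp |u| * (1 - |u|) ≤ Real.exp |u| * Real.exp (-|u|) := by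
            gcongr; linarith
        _ = 1 := by rw [← Real.exp_add]; simp
    have h2 : Real.exp u ≤ Real.exp |u| := Real.exp_le_exp.2 (le_abs_self u)
    have h3 : (Real.exp |u| - 1) * (1 - |u|) ≤ |u| := by linarith
    have h4 : 0 < 1 - |u| := by linarith
    have h5 : Real.exp |u| - 1 ≤ |u| / (1 - |u|) := by rwa [le_div_iff₀ h4]
    calc y ≤ (a - 1) * (|u| / (1 - |u|)) := by
          refine mul_le_mul_of_nonneg_left ?_ (by linarith)
          linarith
      _ ≤ 2 / 5 := by
          rw [← mul_div_assoc, div_le_iff₀ h4]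
          linarith [abs_nonneg u]
  have hyabs : |y| ≤ 2 / 5 := abs_le.2 ⟨hylow, hyup⟩
  -- The linear part of `-log (1 - y)` cancels `(a - 1) * u` up to second order in `u`, leaving a
  -- constant and a term of size `1 / a`.
  refine ⟨by rw [hV]; linarith, ?_⟩
  have hlog := neg_log_one_sub_le hyabs
  have hquad : y - (a - 1) * u ≤ 4 / 25 / a := by
    have h1 := (le_abs_self _).trans (Real.abs_exp_sub_one_sub_id_le (x := u) (by linarith))
    rw [le_div_iff₀ ha0]
    have h2 : y - (a - 1) * u ≤ (a - 1) * u ^ 2 := by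
      rw [hy]; nlinarith
    have h3 : (a - 1) * u ^ 2 * a ≤ (|u| * a) ^ 2 := by
      rw [mul_pow, sq_abs]
      nlinarith [sq_nonneg u, mul_nonneg (sq_nonneg u) ha0.le]
    have h4 : (|u| * a) ^ 2 ≤ (2 / 5) ^ 2 := by gcongr
    nlinarith
  -- For large `a` the right side tends to `2 * l / 9`, which exceeds `0.153` since `l ≥ log 2`; the
  -- constant `36 / 250 = 0.144` just fits.
  have hmain : 36 / 250 + 4 / 25 / a ≤ 2 * l / (3 * a + 2) * (a / 3 + 2) := by
    have hl' : 69 / 100 ≤ l := by linarith [Real.log_two_gt_d9]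
    calc 36 / 250 + 4 / 25 / a ≤ 2 * (69 / 100) / (3 * a + 2) * (a / 3 + 2) := by
          rw [div_mul_eq_mul_div, le_div_iff₀ (by positivity)]
          have : 4 / 25 / a * a = 4 / 25 := by field_simp
          have h1 : 4 / 25 / a ≤ 4 / 25 := div_le_self (by norm_num) ha.le
          nlinarith
      _ ≤ _ := by gcongr
  rw [hV]
  linarith

/-- The deterministic post-processing which turns `μ` and `RDP + SS z_s` into `μ` and
`RDP^upper`. -/
noncomputable def ptrShear (c : ℝ) (z : ℝ × ℝ) : ℝ × ℝ := (z.1, z.2 + c * Real.exp z.1)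

theorem map_affine_normalNoise (σ c d : ℝ) :
    (normalNoise σ).map (fun z => c * z + d) = gaussianReal d (Real.toNNReal ((c * σ) ^ 2)) := by
  have : (fun z : ℝ => c * z + d) = (fun z => z + d) ∘ fun z => c * z := rfl
  rw [this, ← Measure.map_map (by fun_prop) (by fun_prop), gaussianReal_map_const_mul,
    gaussianReal_map_add_const]
  congr 1
  · ring
  · ext
    simp [Real.coe_toNNReal _ (sq_nonneg _), mul_pow]
    positivity

/-- Before the shear the coordinates are independent normals, so the Rényi bound can be computed one
coordinate at a time. -/
theorem ptrTest_eq_map_ptrShear (εhat δ r s : ℝ) :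
    ptrTest εhat δ r s =
      ((gaussianReal (Real.log s + √(2 * Real.log (2 / (δ / 2))) * ptrSigma εhat δ *
          ptrBeta εhat δ) (Real.toNNReal ((ptrBeta εhat δ * ptrSigma εhat δ) ^ 2))).prod
        (gaussianReal r (Real.toNNReal ((s * ptrSigma εhat δ) ^ 2)))).map
        (ptrShear (ptrSigma εhat δ * √(2 * Real.log (2 / (δ / 2))))) := by
  rw [← map_affine_normalNoise, ← map_affine_normalNoise, Measure.map_prod_map _ _ (by fun_prop)
    (by fun_prop), Measure.map_map (by unfold ptrShear; fun_prop) (by fun_prop)]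
  unfold ptrTest
  congr 1
  funext z
  simp only [ptrShear, ptrMu, ptrUpper, Function.comp, Prod.map]
  refine Prod.ext ?_ ?_
  · simp only; ring
  · simp only
    rw [add_comm r]
    congr 3
    ring

theorem renyiBound_ptrTest_of_pos {εhat δ r r' s s' : ℝ} (hεhat : 0 < εhat) (hδ : 0 < δ)
    (hδ1 : δ < 1) (hs : 0 < s) (hs' : 0 < s') (hr : |r - r'| ≤ s')
    (h1 : s ≤ Real.exp (ptrBeta εhat δ) * s') (h2 : s' ≤ Real.exp (ptrBeta εhat δ) * s) :
    RenyiBound (ptrOrder εhat δ) (ptrTest εhat δ r s) (ptrTest εhat δ r' s') (εhat / 2) := by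
  have hα := one_lt_ptrOrder hεhat hδ hδ1
  have hσ := ptrSigma_pos hεhat hα
  have hσ2 := ptrSigma_sq hεhat hα
  have hαε := ptrOrder_sub_one_mul (δ := δ) hεhat
  have hβdef : ptrBeta εhat δ = (1 / 5) / ptrOrder εhat δ := rfl
  rw [ptrTest_eq_map_ptrShear, ptrTest_eq_map_ptrShear]
  generalize √(2 * Real.log (2 / (δ / 2))) = c
  set α := ptrOrder εhat δ
  set σ := ptrSigma εhat δ
  set β := ptrBeta εhat δ
  have hα0 : 0 < α := by linarith
  have hβ : 0 < β := by rw [hβdef]; positivity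
  have hlog : |Real.log s - Real.log s'| ≤ β := by
    have e1 := Real.log_le_log hs h1
    have e2 := Real.log_le_log hs' h2
    rw [Real.log_mul (Real.exp_pos _).ne' (by positivity), Real.log_exp] at e1 e2
    rw [abs_le]
    constructor <;> linarith
  -- The logarithm of the ratio of the variances `(s * σ)²` and `(s' * σ)²`.
  set u := 2 * (Real.log s - Real.log s') with hu
  have hu1 : |u| ≤ 2 / (5 * α) := by
    rw [hu, abs_mul, abs_two]
    calc 2 * |Real.log s - Real.log s'| ≤ 2 * β := by gcongr
      _ = _ := by rw [hβdef]; field_simp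
  have hexpu : Real.exp u * s' ^ 2 = s ^ 2 := by
    have : Real.exp u = (s / s') ^ 2 := by
      rw [hu, ← Real.log_div hs.ne' hs'.ne', mul_comm, Real.exp_mul, Real.exp_log (by positivity)]
      norm_cast
    rw [this]
    field_simp
  obtain ⟨hV, hmis⟩ := variance_mismatch_le (l := Real.log (2 / δ)) hα hu1
    (Real.log_le_log (by norm_num) (by rw [le_div_iff₀ hδ]; linarith))
  set V := α - (α - 1) * Real.exp u with hVdef
  have hα1 : 0 < α - 1 := by linarith
  refine RenyiBound.map (ψ := fun z => (z.1, z.2 - σ * c * Real.exp z.1)) ?_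
    (by unfold ptrShear; fun_prop) (by fun_prop) (fun z => by simp [ptrShear])
  -- The budgets of the two coordinates; this identity is what fixes `σ² = (3α + 2) / εhat`.
  have hsum : εhat / 2 = α / (2 * σ ^ 2) + (α + 1) / σ ^ 2 := by
    rw [hσ2]; field_simp; ring
  rw [hsum]
  refine RenyiBound.prod hα0.le (renyiBound_gaussianReal ?_ ?_ ?_ ?_)
    (renyiBound_gaussianReal ?_ ?_ ?_ ?_)
  · exact Real.toNNReal_pos.2 (by positivity)
  · exact Real.toNNReal_pos.2 (by positivity)
  · rw [Real.coe_toNNReal _ (sq_nonneg _)]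
    have : 0 < (β * σ) ^ 2 := by positivity
    linarith
  · rw [Real.coe_toNNReal _ (sq_nonneg _)]
    have e : α * (β * σ) ^ 2 - (α - 1) * (β * σ) ^ 2 = (β * σ) ^ 2 := by ring
    have hp : 0 < (β * σ) ^ 2 := by positivity
    rw [e, div_self hp.ne', Real.log_one, add_sub_add_right_eq_sub]
    have hsq : (Real.log s - Real.log s') ^ 2 ≤ β ^ 2 := by
      rw [← sq_abs]; gcongr
    calc _ ≤ (α - 1) / 2 * 0 + 0 / 2 + α * (α - 1) * β ^ 2 / (2 * (β * σ) ^ 2) := by gcongr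
      _ = _ := by field_simp; ring
  · exact Real.toNNReal_pos.2 (by positivity)
  · exact Real.toNNReal_pos.2 (by positivity)
  · rw [Real.coe_toNNReal _ (sq_nonneg _), Real.coe_toNNReal _ (sq_nonneg _)]
    have : α * (s' * σ) ^ 2 - (α - 1) * (s * σ) ^ 2 = V * (s' * σ) ^ 2 := by
      rw [hVdef, mul_pow s, ← hexpu]; ring
    rw [this]
    positivity
  · rw [Real.coe_toNNReal _ (sq_nonneg _), Real.coe_toNNReal _ (sq_nonneg _)]
    have e : α * (s' * σ) ^ 2 - (α - 1) * (s * σ) ^ 2 = V * (s' * σ) ^ 2 := by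
      rw [hVdef, mul_pow s, ← hexpu]; ring
    have hV0 : 0 < V := by linarith
    have hp : 0 < (s' * σ) ^ 2 := by positivity
    have l1 : Real.log ((s' * σ) ^ 2 / (s * σ) ^ 2) = -u := by
      rw [mul_pow, mul_pow, mul_div_mul_right _ _ (by positivity), Real.log_div (by positivity)
        (by positivity), Real.log_pow, Real.log_pow, hu]
      push_cast; ring
    have l2 : Real.log ((s' * σ) ^ 2 / (V * (s' * σ) ^ 2)) = -Real.log V := by
      rw [div_mul_cancel_right₀ hp.ne', Real.log_inv]
    rw [e, l1, l2]
    have hr2 : (r - r') ^ 2 ≤ s' ^ 2 := by rw [← sq_abs]; gcongr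
    -- Since `V ≥ 3 / 5`, unequal variances inflate the cost of the mean shift by at most `5 / 3`.
    have t3 : α * (α - 1) * (r - r') ^ 2 / (2 * (V * (s' * σ) ^ 2))
        ≤ Real.log (2 / δ) / (3 * α + 2) * (5 * α / 3) := by
      calc α * (α - 1) * (r - r') ^ 2 / (2 * (V * (s' * σ) ^ 2))
          ≤ α * (α - 1) * s' ^ 2 / (2 * ((3 / 5) * (s' * σ) ^ 2)) := by gcongr
        _ = ((α - 1) * εhat) / (3 * α + 2) * (5 * α / 3) / 2 := by
          rw [mul_pow, hσ2]; field_simp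
        _ = _ := by rw [hαε]; ring
    have t4 : (α - 1) * ((α + 1) / σ ^ 2) = 2 * Real.log (2 / δ) / (3 * α + 2) * (α + 1) := by
      rw [hσ2, ← hαε]; field_simp
    rw [t4]
    have t5 : 2 * Real.log (2 / δ) / (3 * α + 2) * (α + 1)
        = (2 * Real.log (2 / δ) / (3 * α + 2) * (α / 3 + 2)) / 2
          + Real.log (2 / δ) / (3 * α + 2) * (5 * α / 3) := by ring
    -- Split `α + 1 = (α / 3 + 2) / 2 + 5α / 6`: the first summand pays for the variances, the
    -- second for the means.
    rw [t5]
    linarith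

instance (εhat δ r s : ℝ) : IsProbabilityMeasure (ptrTest εhat δ r s) := by
  refine Measure.isProbabilityMeasure_map (Measurable.aemeasurable ?_)
  unfold ptrUpper ptrMu
  fun_prop

/-- On neighbouring datasets the test is private, also in the degenerate case. -/
theorem renyiBound_ptrTest {εhat δ r r' s s' : ℝ} (hεhat : 0 < εhat) (hδ : 0 < δ)
    (hδ1 : δ < 1) (hr : |r - r'| ≤ s) (hr' : |r' - r| ≤ s')
    (h1 : s ≤ Real.exp (ptrBeta εhat δ) * s') (h2 : s' ≤ Real.exp (ptrBeta εhat δ) * s) :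
    RenyiBound (ptrOrder εhat δ) (ptrTest εhat δ r s) (ptrTest εhat δ r' s') (εhat / 2) := by
  have hs : 0 ≤ s := (abs_nonneg _).trans hr
  have hs' : 0 ≤ s' := (abs_nonneg _).trans hr'
  rcases hs.eq_or_lt with rfl | hs
  · have : s' = 0 := le_antisymm (by simpa using h2) hs'
    subst this
    have : r = r' := by
      have := abs_nonpos_iff.1 hr
      linarith
    subst this
    exact (RenyiBound.refl _).mono (one_lt_ptrOrder hεhat hδ hδ1).le (by positivity)
  · have hs'0 : 0 < s' := by
      by_contra h
      have : s' = 0 := le_antisymm (not_lt.1 h) hs'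
      subst this
      simp at h1
      linarith
    exact renyiBound_ptrTest_of_pos hεhat hδ hδ1 hs hs'0 (by rwa [abs_sub_comm]) h1 h2

/-- Except with probability `δ / 2`, the released number `RDP^upper` is an upper bound. -/
theorem ptrTest_upper_lt_le {εhat δ r s : ℝ} (hεhat : 0 < εhat) (hδ : 0 < δ)
    (hδ1 : δ < 1) (hs : 0 ≤ s) :
    ptrTest εhat δ r s {w | w.2 < r} ≤ ENNReal.ofReal (δ / 2) := by
  have hα := one_lt_ptrOrder hεhat hδ hδ1
  have hσ := ptrSigma_pos hεhat hα
  have hβ : 0 < ptrBeta εhat δ := by unfold ptrBeta; positivity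
  have hc0 : 0 ≤ Real.log (2 / (δ / 2)) :=
    Real.log_nonneg (by rw [le_div_iff₀ (by positivity)]; linarith)
  set c := √(2 * Real.log (2 / (δ / 2))) with hc
  have hcpos : 0 ≤ c := Real.sqrt_nonneg _
  have htail : normalNoise (ptrSigma εhat δ) (Set.Iic (-(c * ptrSigma εhat δ)))
      ≤ ENNReal.ofReal (δ / 4) := by
    refine (normalNoise_Iic_le hσ c hcpos).trans_eq ?_
    congr 1
    rw [hc, Real.sq_sqrt (by positivity), neg_div, mul_div_cancel_left₀ _ two_ne_zero,
      Real.exp_neg, Real.exp_log (by positivity)]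
    field_simp
    norm_num
  unfold ptrTest
  rw [Measure.map_apply (by unfold ptrUpper ptrMu; fun_prop)
    (measurableSet_lt (by fun_prop) (by fun_prop))]
  set N := normalNoise (ptrSigma εhat δ)
  set I := Set.Iic (-(c * ptrSigma εhat δ))
  -- If both noises exceed `-(c * σ)`, then `e^μ ≥ s`, so the last term of `RDP^upper` outweighs `s
  -- * z_s`. Each exception has mass at most `δ / 4`.
  calc _ ≤ (N.prod N) (I ×ˢ Set.univ ∪ Set.univ ×ˢ I) := by
        refine measure_mono fun z hz => ?_
        by_contra hI
        simp only [I, Set.mem_union, Set.mem_prod, Set.mem_Iic, Set.mem_univ, and_true, true_and,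
          not_or, not_le] at hI
        have hz : ptrUpper εhat δ r s z.1 z.2 < r := hz
        simp only [ptrUpper, ptrMu, ← hc] at hz
        rcases hs.eq_or_lt with rfl | hs
        -- For `s = 0` the noise term vanishes and the correction is nonnegative, whatever `log 0`
        -- is.
        · have : 0 ≤ ptrSigma εhat δ * c * Real.exp (Real.log 0 + ptrBeta εhat δ * z.1
            + c * ptrSigma εhat δ * ptrBeta εhat δ) := by positivity
          linarith
        · have h1 : s ≤ Real.exp (Real.log s + ptrBeta εhat δ * z.1
              + c * ptrSigma εhat δ * ptrBeta εhat δ) := by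
            rw [← Real.log_le_iff_le_exp hs]
            nlinarith
          have h2 := mul_le_mul_of_nonneg_left h1 (mul_nonneg hσ.le hcpos)
          have h3 : s * -(c * ptrSigma εhat δ) < s * z.2 := by gcongr; exact hI.2
          linarith
    _ ≤ (N.prod N) (I ×ˢ Set.univ) + (N.prod N) (Set.univ ×ˢ I) := measure_union_le _ _
    _ ≤ ENNReal.ofReal (δ / 4) + ENNReal.ofReal (δ / 4) := by
        rw [Measure.prod_prod, Measure.prod_prod, measure_univ, mul_one, one_mul]
        gcongr
    _ = _ := by
        rw [← ENNReal.ofReal_add (by positivity) (by positivity)]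
        congr 1; ring

/-! ### Smooth sensitivity -/

section Sensitivity

variable {Z : Type*} {n : ℕ}

theorem recordDist_comm (X Y : Fin n → Z) : recordDist X Y = recordDist Y X := by
  classical
  exact hammingDist_comm X Y

theorem recordDist_triangle (X Y W : Fin n → Z) :
    recordDist X W ≤ recordDist X Y + recordDist Y W := by
  classical
  exact hammingDist_triangle X Y W

theorem recordDist_self (X : Fin n → Z) : recordDist X X = 0 := by
  classical
  exact hammingDist_self X

theorem Neighbor.symm {X Y : Fin n → Z} (h : Neighbor X Y) : Neighbor Y X := by
  unfold Neighbor at *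
  rwa [recordDist_comm]

theorem neighbor_refl (X : Fin n → Z) : Neighbor X X := by
  simp [Neighbor, recordDist_self]

/-- The ball of radius `d` about `X` lies in the ball of radius `d + 1` about `X'`; the extra step
costs `e^β`. -/
theorem smoothSensitivity_le_exp_mul (β : ℝ) (f : (Fin n → Z) → ℝ) {X X' : Fin n → Z}
    (h : Neighbor X X') :
    smoothSensitivity β f X ≤ ENNReal.ofReal (Real.exp β) * smoothSensitivity β f X' := by
  refine iSup_le fun d => ?_
  have h1 : ENNReal.ofReal (Real.exp (-(β * d)))
      = ENNReal.ofReal (Real.exp β) * ENNReal.ofReal (Real.exp (-(β * (d + 1 : ℕ)))) := by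
    rw [← ENNReal.ofReal_mul (Real.exp_nonneg _), ← Real.exp_add]
    push_cast
    ring_nf
  rw [h1, mul_assoc]
  refine mul_le_mul' le_rfl (le_trans ?_ (le_iSup _ (d + 1)))
  refine mul_le_mul' le_rfl (iSup₂_le fun Y hY => ?_)
  refine le_iSup₂_of_le Y ?_ le_rfl
  have := recordDist_triangle X' X Y
  have h' : recordDist X' X ≤ 1 := h.symm
  omega

theorem ofReal_abs_sub_le_smoothSensitivity (β : ℝ) (f : (Fin n → Z) → ℝ) {X X' : Fin n → Z}
    (h : Neighbor X X') : ENNReal.ofReal |f X - f X'| ≤ smoothSensitivity β f X := by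
  refine le_trans ?_ (le_iSup _ 0)
  simp only [Nat.cast_zero, mul_zero, neg_zero, Real.exp_zero, ENNReal.ofReal_one, one_mul]
  refine le_iSup₂_of_le X (by simp [recordDist_self]) ?_
  exact le_iSup₂_of_le (f := fun X' _ => ENNReal.ofReal |f X - f X'|) X' h le_rfl

/-- Needed because `toReal` sends `∞` to `0`, which would bound nothing. -/
theorem smoothSensitivity_ne_top {β : ℝ} (hβ : 0 ≤ β) {f : (Fin n → Z) → ℝ} {B : ℝ}
    (hB : ∀ X Y, |f X - f Y| ≤ B) (X : Fin n → Z) : smoothSensitivity β f X ≠ ∞ := by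
  refine ne_top_of_le_ne_top (ENNReal.ofReal_ne_top (r := B)) (iSup_le fun d => ?_)
  rw [← one_mul (ENNReal.ofReal B)]
  refine mul_le_mul' ?_ (iSup₂_le fun Y _ => iSup₂_le fun Y' _ =>
    ENNReal.ofReal_le_ofReal (hB Y Y'))
  rw [← ENNReal.ofReal_one]
  refine ENNReal.ofReal_le_ofReal (Real.exp_le_one_iff.2 ?_)
  have : 0 ≤ β * d := by positivity
  linarith

/-- The smooth sensitivity of a function of bounded oscillation is a smooth sensitivity bound. -/
theorem isSmoothSensitivityBound_smoothSensitivity {β : ℝ} (hβ : 0 ≤ β) {f : (Fin n → Z) → ℝ}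
    {B : ℝ} (hB : ∀ X Y, |f X - f Y| ≤ B) :
    IsSmoothSensitivityBound β f fun X => (smoothSensitivity β f X).toReal := by
  refine ⟨fun X X' h => ?_, fun X X' h => ?_⟩
  · rw [← ENNReal.ofReal_le_iff_le_toReal (smoothSensitivity_ne_top hβ hB X)]
    exact ofReal_abs_sub_le_smoothSensitivity β f h
  · have := ENNReal.toReal_mono (ENNReal.mul_ne_top ENNReal.ofReal_ne_top
      (smoothSensitivity_ne_top hβ hB X')) (smoothSensitivity_le_exp_mul β f h)
    rwa [ENNReal.toReal_mul, ENNReal.toReal_ofReal (Real.exp_nonneg _)] at this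

end Sensitivity

/-! ### The optimal data-dependent RDP function -/

section OptimalRDP

variable {Z S : Type*} [MeasurableSpace S] {n : ℕ}

/-- A dataset may have infinitely many neighbours, but with finitely many output laws the supremum
is attained. -/
theorem iSup_renyiDiv_mem (M : (Fin n → Z) → Measure S) (α : ℝ) (hM : (Set.range M).Finite)
    (X : Fin n → Z) :
    (⨆ (X' : Fin n → Z) (_ : Neighbor X X'), renyiDiv α (M X) (M X'))
      ∈ Set.image2 (renyiDiv α) (Set.range M) (Set.range M) := by
  have e : (⨆ (X' : Fin n → Z) (_ : Neighbor X X'), renyiDiv α (M X) (M X'))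
      = sSup ((fun X' => renyiDiv α (M X) (M X')) '' {X' | Neighbor X X'}) := sSup_image.symm
  have hsub : (fun X' => renyiDiv α (M X) (M X')) '' {X' | Neighbor X X'}
      ⊆ Set.image2 (renyiDiv α) (Set.range M) (Set.range M) := by
    rintro _ ⟨X', -, rfl⟩
    exact ⟨_, ⟨X, rfl⟩, _, ⟨X', rfl⟩, rfl⟩
  rw [e]
  exact hsub (Set.Nonempty.csSup_mem ⟨_, X, neighbor_refl X, rfl⟩ ((hM.image2 _ hM).subset hsub))

theorem isDataDependentRDP_optimalRDP {M : (Fin n → Z) → Measure S} {α : ℝ}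
    (hM : (Set.range M).Finite) (htop : ∀ X X', renyiDiv α (M X) (M X') ≠ ⊤) :
    IsDataDependentRDP M α (optimalRDP M α) := by
  intro X X' h
  refine (le_iSup₂_of_le (f := fun X' _ => renyiDiv α (M X) (M X')) X' h le_rfl).trans
    (EReal.le_coe_toReal ?_)
  obtain ⟨_, ⟨Y, rfl⟩, _, ⟨Y', rfl⟩, hY⟩ := iSup_renyiDiv_mem M α hM X
  rw [← hY]
  exact htop Y Y'

theorem exists_abs_optimalRDP_sub_le (M : (Fin n → Z) → Measure S) (α : ℝ)
    (hM : (Set.range M).Finite) : ∃ B, ∀ X Y, |optimalRDP M α X - optimalRDP M α Y| ≤ B := by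
  have hfin : (Set.range (optimalRDP M α)).Finite := by
    refine ((hM.image2 (renyiDiv α) hM).image EReal.toReal).subset ?_
    rintro _ ⟨X, rfl⟩
    exact ⟨_, iSup_renyiDiv_mem M α hM X, rfl⟩
  obtain ⟨C, hC⟩ := hfin.isBounded.exists_norm_le
  refine ⟨C + C, fun X Y => (abs_sub _ _).trans (add_le_add (hC _ ⟨X, rfl⟩) (hC _ ⟨Y, rfl⟩))⟩

end OptimalRDP

/-- On a finite space the Rényi divergence is finite as soon as the second law charges every
point. -/
theorem renyiDiv_ne_top_of_finite {S : Type*} [Finite S] [MeasurableSpace S]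
    [MeasurableSingletonClass S] {α : ℝ} (hα : 1 < α) (P Q : Measure S) [IsFiniteMeasure P]
    [IsFiniteMeasure Q] (hQ : ∀ x, Q {x} ≠ 0) : renyiDiv α P Q ≠ ⊤ := by
  have := Fintype.ofFinite S
  have hQ0 : ∀ A : Set S, Q A = 0 → A = ∅ := by
    intro A hA
    by_contra hne
    obtain ⟨x, hx⟩ := Set.nonempty_iff_ne_empty.2 hne
    exact hQ x (measure_mono_null (Set.singleton_subset_iff.2 hx) hA)
  have hPQ : P ≪ Q := fun A hA => by simp [hQ0 A hA]
  have hfin : ∫⁻ o, (P.rnDeriv Q o) ^ α ∂Q < ∞ := by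
    rw [lintegral_fintype]
    refine ENNReal.sum_lt_top.2 fun x _ => ENNReal.mul_lt_top ?_ (measure_lt_top _ _)
    refine ENNReal.rpow_lt_top_of_nonneg (by linarith) ?_
    -- The density is finite `Q`-almost everywhere, hence everywhere, as `Q` has no nonempty null
    -- set.
    have h := hQ0 _ (ae_iff.1 (Measure.rnDeriv_lt_top P Q))
    intro hx
    have : x ∈ (∅ : Set S) := by
      rw [← h]
      simp [hx]
    exact this
  unfold renyiDiv
  rw [if_pos hPQ]
  have hlog : ENNReal.log (∫⁻ o, (P.rnDeriv Q o) ^ α ∂Q) < ⊤ := ENNReal.log_lt_top_iff.2 hfin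
  have hpos : 0 < (α - 1)⁻¹ := inv_pos.2 (by linarith)
  generalize ENNReal.log _ = l at hlog
  induction l using EReal.rec with
  | bot => simp [EReal.coe_mul_bot_of_pos hpos]
  | top => simp at hlog
  | coe l => rw [← EReal.coe_mul]; exact EReal.coe_ne_top _

/-! ### The noisy labels -/

theorem argmaxLabel_eq_of_lt {C : ℕ} [NeZero C] {v : Fin C → ℝ} {j : Fin C}
    (h : ∀ k, k ≠ j → v k < v j) : argmaxLabel v = j := by
  have hmem : argmaxLabel v ∈ Finset.univ.filter fun j => ∀ k, v k ≤ v j :=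
    Finset.min'_mem _ _
  by_contra hne
  exact (h _ hne).not_ge ((Finset.mem_filter.1 hmem).2 j)

namespace PATE

variable {Z U Θ : Type*} [MeasurableSpace Θ] {n K T C : ℕ} [NeZero C]

/-- The law depends on the data only through the vote counts, which lie in `{0, …, K}`. -/
theorem finite_range_noisyLabels (P : PATE Z U Θ n K T C) (σ₁ : ℝ) :
    (Set.range (P.noisyLabels σ₁)).Finite := by
  have hlt : ∀ X x j, P.votes X x j < K + 1 := fun X x j =>
    Nat.lt_succ_of_le ((Finset.card_le_univ _).trans_eq (Fintype.card_fin K))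
  let F : (Fin T → Fin C → Fin (K + 1)) → Measure (Fin T → Fin C) := fun v =>
    (Measure.pi fun _ : Fin T => Measure.pi fun _ : Fin C => normalNoise σ₁).map
      fun g i => argmaxLabel fun j => ((v i j : ℕ) : ℝ) + g i j
  refine (Set.finite_range F).subset ?_
  rintro _ ⟨X, rfl⟩
  exact ⟨fun i j => ⟨P.votes X (P.query i) j, hlt _ _ _⟩, rfl⟩

/-- The noises that make `y` the strict winner at every query form a nonempty open set, and normal
noise charges every such set. -/
theorem noisyLabels_singleton_ne_zero (P : PATE Z U Θ n K T C) {σ₁ : ℝ} (hσ₁ : 0 < σ₁)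
    (X : Fin n → Z) (y : Fin T → Fin C) : P.noisyLabels σ₁ X {y} ≠ 0 := by
  have : (normalNoise σ₁).IsOpenPosMeasure := by
    refine (gaussianReal_absolutelyContinuous' 0 ?_).isOpenPosMeasure
    exact (Real.toNNReal_pos.2 (by positivity)).ne'
  have : (Measure.pi fun _ : Fin C => normalNoise σ₁).IsOpenPosMeasure :=
    Measure.pi.isOpenPosMeasure _
  have : (Measure.pi fun _ : Fin T =>
      Measure.pi fun _ : Fin C => normalNoise σ₁).IsOpenPosMeasure :=
    Measure.pi.isOpenPosMeasure _
  let O : Set (Fin T → Fin C → ℝ) := {g | ∀ i k, k ≠ y i →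
    (P.votes X (P.query i) k : ℝ) + g i k < P.votes X (P.query i) (y i) + g i (y i)}
  have hO : IsOpen O := by
    have : O = ⋂ i, ⋂ k, ⋂ (_ : k ≠ y i), {g | (P.votes X (P.query i) k : ℝ) + g i k
        < P.votes X (P.query i) (y i) + g i (y i)} := by
      ext g; simp [O]
    rw [this]
    refine isOpen_iInter_of_finite fun i => isOpen_iInter_of_finite fun k =>
      isOpen_iInter_of_finite fun _ => isOpen_lt (by fun_prop) (by fun_prop)
  have hne : O.Nonempty := by
    -- This noise cancels all votes and gives one vote to the desired label.
    refine ⟨fun i k => (if k = y i then 1 else 0) - P.votes X (P.query i) k, fun i k hk => ?_⟩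
    simp [hk]
  have hpos : (Measure.pi fun _ : Fin T => Measure.pi fun _ : Fin C => normalNoise σ₁) O ≠ 0 :=
    (hO.measure_pos _ hne).ne'
  intro h0
  refine hpos (measure_mono_null ?_ (Measure.preimage_null_of_map_null ?_ h0))
  · intro g hg
    funext i
    exact argmaxLabel_eq_of_lt fun k hk => hg i k hk
  · refine Measurable.aemeasurable (measurable_pi_lambda _ fun i => measurable_argmaxLabel.comp ?_)
    fun_prop

theorem isDataDependentRDP_labelRDP (P : PATE Z U Θ n K T C) {σ₁ εhat δ : ℝ} (hσ₁ : 0 < σ₁)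
    (hα : 1 < ptrOrder εhat δ) :
    IsDataDependentRDP (P.noisyLabels σ₁) (ptrOrder εhat δ) (P.labelRDP σ₁ εhat δ) :=
  isDataDependentRDP_optimalRDP (P.finite_range_noisyLabels σ₁) fun _ X' =>
    renyiDiv_ne_top_of_finite hα _ _ (P.noisyLabels_singleton_ne_zero hσ₁ X')

theorem isSmoothSensitivityBound_labelSS (P : PATE Z U Θ n K T C) {σ₁ εhat δ : ℝ}
    (hα : 1 < ptrOrder εhat δ) :
    IsSmoothSensitivityBound (ptrBeta εhat δ) (P.labelRDP σ₁ εhat δ) (P.labelSS σ₁ εhat δ) := by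
  obtain ⟨B, hB⟩ := exists_abs_optimalRDP_sub_le (P.noisyLabels σ₁) (ptrOrder εhat δ)
    (P.finite_range_noisyLabels σ₁)
  exact isSmoothSensitivityBound_smoothSensitivity (by unfold ptrBeta; positivity) hB

end PATE

/-! ### Privacy of the algorithm -/

namespace PATE

variable {Z U Θ : Type*} [MeasurableSpace Θ] {n K T C : ℕ}

/-- Conditional probability of the event `A` on the released value, given the numbers released by
the test and the noisy labels. -/
noncomputable def releaseProb (P : PATE Z U Θ n K T C) (ε' εhat δ : ℝ)
    (A : Set (ℝ × ℝ × (Θ ⊕ Unit))) (p : (ℝ × ℝ) × (Fin T → Fin C)) : ℝ≥0∞ :=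
  (P.student fun i => (P.query i, p.2 i) : Measure Θ) {θ | ptrRelease ε' εhat δ (p.1, θ) ∈ A}

theorem releaseProb_le_one (P : PATE Z U Θ n K T C) (ε' εhat δ : ℝ)
    (A : Set (ℝ × ℝ × (Θ ⊕ Unit))) (p : (ℝ × ℝ) × (Fin T → Fin C)) :
    P.releaseProb ε' εhat δ A p ≤ 1 := prob_le_one

theorem measurable_releaseProb (P : PATE Z U Θ n K T C) (ε' εhat δ : ℝ)
    {A : Set (ℝ × ℝ × (Θ ⊕ Unit))} (hA : MeasurableSet A) :
    Measurable (P.releaseProb ε' εhat δ A) :=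
  measurable_from_prod_countable_left fun y =>
    measurable_measure_prodMk_left (ν := (P.student fun i => (P.query i, y i) : Measure Θ))
      (measurable_ptrRelease ε' εhat δ hA)

/-- Integrating out the training of the student turns the event into a `[0, 1]`-valued test on the
numbers and labels, to which `RenyiBound.lintegral_le` applies. -/
theorem ptrTranscript_apply [NeZero C] (P : PATE Z U Θ n K T C) (σ₁ ε' εhat δ : ℝ)
    (rdp SS : (Fin n → Z) → ℝ) (X : Fin n → Z) {A : Set (ℝ × ℝ × (Θ ⊕ Unit))}
    (hA : MeasurableSet A) :
    P.ptrTranscript σ₁ ε' εhat δ rdp SS X A = ∫⁻ p, P.releaseProb ε' εhat δ A p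
      ∂(ptrTest εhat δ (rdp X) (SS X)).prod (P.noisyLabels σ₁ X) := by
  have hB := measurable_ptrRelease ε' εhat δ hA (Θ := Θ)
  unfold ptrTranscript
  rw [Measure.map_apply (measurable_ptrRelease _ _ _) hA, Measure.prod_apply hB,
    lintegral_prod _ (P.measurable_releaseProb ε' εhat δ hA).aemeasurable]
  refine lintegral_congr fun w => ?_
  unfold studentModel
  rw [Measure.bind_apply (measurable_prodMk_left hB) Measurable.of_discrete.aemeasurable]
  rfl

theorem isDP_ptrTranscript [NeZero C] (P : PATE Z U Θ n K T C) {σ₁ ε' εhat δ : ℝ} (hε' : 0 ≤ ε')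
    (hεhat : 0 < εhat) (hδ : 0 < δ) (hδ1 : δ < 1) {rdp SS : (Fin n → Z) → ℝ}
    (hrdp : IsDataDependentRDP (P.noisyLabels σ₁) (ptrOrder εhat δ) rdp)
    (hSS : IsSmoothSensitivityBound (ptrBeta εhat δ) rdp SS) :
    IsDP (P.ptrTranscript σ₁ ε' εhat δ rdp SS) (ε' + εhat) δ := by
  intro X X' h A hA
  have hα := one_lt_ptrOrder hεhat hδ hδ1
  have hlog : Real.log (2 / δ) = (ptrOrder εhat δ - 1) * (εhat / 2) := by
    linarith [ptrOrder_sub_one_mul (δ := δ) hεhat]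
  have hexp : Real.exp (-((ptrOrder εhat δ - 1) * (εhat / 2))) = δ / 2 := by
    rw [← hlog, Real.exp_neg, Real.exp_log (by positivity), inv_div]
  have hconv : ∀ u, rdpToDP (ptrOrder εhat δ) (δ / 2) u = u + εhat / 2 := by
    intro u
    unfold rdpToDP
    rw [one_div_div, hlog, mul_div_cancel_left₀ _ (by linarith)]
  have htest := renyiBound_ptrTest (r := rdp X) (r' := rdp X') hεhat hδ hδ1 (hSS.1 X X' h)
    (hSS.1 X' X h.symm) (hSS.2 X X' h) (hSS.2 X' X h.symm)
  have hf := P.measurable_releaseProb ε' εhat δ hA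
  rw [P.ptrTranscript_apply _ _ _ _ _ _ _ hA, P.ptrTranscript_apply _ _ _ _ _ _ _ hA]
  rcases le_or_gt (rdp X + εhat / 2) ε' with hr | hr
  · have hlab := RenyiBound.of_renyiDiv_le hα (hrdp X X' h)
    refine ((htest.prod (by linarith) hlab).lintegral_le hα (ε' + εhat) hf
      (P.releaseProb_le_one _ _ _ _)).trans ?_
    gcongr
    calc _ ≤ Real.exp (-((ptrOrder εhat δ - 1) * (εhat / 2))) := by
          rw [Real.exp_le_exp, ← mul_neg]
          exact mul_le_mul_of_nonneg_left (by linarith) (by linarith)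
      _ ≤ δ := by rw [hexp]; linarith
  · -- If the test passes then it has underestimated the RDP function.
    -- The outcomes for which the test fails and the resulting release lies in `A`.
    let F : Set (ℝ × ℝ) := {w | ε' < w.2 + εhat / 2 ∧ (w.1, w.2, Sum.inr ()) ∈ A}
    have hF : MeasurableSet F := by
      refine (measurableSet_lt (f := fun _ => ε') (g := fun w : ℝ × ℝ => w.2 + εhat / 2)
        (by fun_prop) (by fun_prop)).inter ?_
      have : Measurable fun w : ℝ × ℝ => (w.1, w.2, (Sum.inr () : Θ ⊕ Unit)) := by fun_prop
      exact this hA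
    have hfail : ∀ (w : ℝ × ℝ) (y : Fin T → Fin C), ε' < w.2 + εhat / 2 →
        P.releaseProb ε' εhat δ A (w, y) = F.indicator 1 w := by
      intro w y hw
      have hrel : ∀ θ : Θ, ptrRelease ε' εhat δ (w, θ) = (w.1, w.2, Sum.inr ()) := fun θ => by
        simp [ptrRelease, hconv, hw]
      by_cases hwA : (w.1, w.2, (Sum.inr () : Θ ⊕ Unit)) ∈ A <;>
        simp [releaseProb, hrel, F, hw, hwA]
    -- At `X'` the passing outcomes are simply dropped, so nothing about the labels there is needed.
    have hlow : ∀ w y, F.indicator 1 w ≤ P.releaseProb ε' εhat δ A (w, y) := by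
      intro w y
      by_cases hw : ε' < w.2 + εhat / 2
      · rw [hfail w y hw]
      · simp [F, hw]
    have hup : ∀ w y, P.releaseProb ε' εhat δ A (w, y)
        ≤ F.indicator 1 w + {w : ℝ × ℝ | w.2 < rdp X}.indicator 1 w := by
      intro w y
      by_cases hw : ε' < w.2 + εhat / 2
      · rw [hfail w y hw]
        exact le_self_add
      · have hwr : w.2 < rdp X := by linarith
        refine (P.releaseProb_le_one _ _ _ _ _).trans ?_
        simp [hwr]
    have hFm : Measurable (F.indicator (1 : ℝ × ℝ → ℝ≥0∞)) := measurable_one.indicator hF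
    have hUm : MeasurableSet {w : ℝ × ℝ | w.2 < rdp X} :=
      measurableSet_lt (by fun_prop) (by fun_prop)
    -- Rényi cost `εhat / 2` converted at `εhat`: the slack `εhat / 2` gives exactly `δ / 2`.
    have hdp := htest.lintegral_le hα εhat hFm fun w => by
      by_cases hw : w ∈ F <;> simp [hw]
    rw [show (ptrOrder εhat δ - 1) * (εhat / 2 - εhat)
      = -((ptrOrder εhat δ - 1) * (εhat / 2)) by ring, hexp] at hdp
    have hmarg : ∀ (μ : Measure (ℝ × ℝ)) (ν : Measure (Fin T → Fin C)) [IsProbabilityMeasure μ]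
        [IsProbabilityMeasure ν] (g : ℝ × ℝ → ℝ≥0∞), Measurable g →
        ∫⁻ p, g p.1 ∂μ.prod ν = ∫⁻ w, g w ∂μ := by
      intro μ ν _ _ g hg
      rw [lintegral_prod _ (by fun_prop)]
      simp
    calc _ ≤ ∫⁻ p, (F.indicator 1 p.1 + {w : ℝ × ℝ | w.2 < rdp X}.indicator 1 p.1)
          ∂(ptrTest εhat δ (rdp X) (SS X)).prod (P.noisyLabels σ₁ X) :=
          lintegral_mono fun p => hup p.1 p.2
      _ = ∫⁻ w, F.indicator 1 w ∂ptrTest εhat δ (rdp X) (SS X)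
          + ptrTest εhat δ (rdp X) (SS X) {w | w.2 < rdp X} := by
          rw [hmarg _ _ (fun w => F.indicator 1 w + {w : ℝ × ℝ | w.2 < rdp X}.indicator 1 w)
            (hFm.add (measurable_one.indicator hUm)), lintegral_add_left hFm,
            lintegral_indicator_one hUm]
      _ ≤ (ENNReal.ofReal (Real.exp εhat) * ∫⁻ w, F.indicator 1 w ∂ptrTest εhat δ (rdp X') (SS X')
          + ENNReal.ofReal (δ / 2)) + ENNReal.ofReal (δ / 2) := by
          gcongr
          exact ptrTest_upper_lt_le hεhat hδ hδ1
            ((abs_nonneg _).trans (hSS.1 X X (neighbor_refl X)))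
      _ = ENNReal.ofReal (Real.exp εhat) * ∫⁻ p, F.indicator 1 p.1
            ∂(ptrTest εhat δ (rdp X') (SS X')).prod (P.noisyLabels σ₁ X')
          + ENNReal.ofReal δ := by
          rw [hmarg _ _ _ hFm, add_assoc, ← ENNReal.ofReal_add (by positivity) (by positivity),
            add_halves]
      _ ≤ _ := by
          gcongr
          · linarith
          · exact hlow _ _

theorem isDP_ptr_of_ptrTranscript [NeZero C] (P : PATE Z U Θ n K T C) {σ₁ ε' εhat δ ε δ₀ : ℝ}
    {rdp SS : (Fin n → Z) → ℝ} (h : IsDP (P.ptrTranscript σ₁ ε' εhat δ rdp SS) ε δ₀) :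
    IsDP (P.ptr σ₁ ε' εhat δ rdp SS) ε δ₀ := by
  intro X X' hX A hA
  have hm : Measurable fun w : ℝ × ℝ × (Θ ⊕ Unit) => w.2.2 := by fun_prop
  unfold ptr
  rw [Measure.map_apply hm hA, Measure.map_apply hm hA]
  exact h X X' hX _ (hm hA)

end PATE

/-- PATE with generalized PTR is `(ε' + ε̂, δ)`-DP: in its literal form, run with the data-dependent
RDP of the noisy labels and its smooth sensitivity, and for every data-dependent RDP function of the
noisy labels and every smooth sensitivity bound of it. In both cases this holds for the returned
value, and also when `μ` and `RDP^upper` are released along with it. -/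
theorem theorem5p6 {Z U Θ : Type*} [MeasurableSpace Θ] {n K T C : ℕ} [NeZero C]
    (P : PATE Z U Θ n K T C) (σ₁ ε' εhat δ : ℝ)
    (hσ₁ : 0 < σ₁) (hε' : 0 ≤ ε') (hεhat : 0 < εhat) (hδ : 0 < δ) (hδ1 : δ < 1) :
    (IsDP (P.ptr σ₁ ε' εhat δ (P.labelRDP σ₁ εhat δ) (P.labelSS σ₁ εhat δ)) (ε' + εhat) δ ∧
      IsDP (P.ptrTranscript σ₁ ε' εhat δ (P.labelRDP σ₁ εhat δ) (P.labelSS σ₁ εhat δ))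
        (ε' + εhat) δ) ∧
    ∀ rdp SS : (Fin n → Z) → ℝ,
      IsDataDependentRDP (P.noisyLabels σ₁) (ptrOrder εhat δ) rdp →
      IsSmoothSensitivityBound (ptrBeta εhat δ) rdp SS →
      IsDP (P.ptr σ₁ ε' εhat δ rdp SS) (ε' + εhat) δ ∧
        IsDP (P.ptrTranscript σ₁ ε' εhat δ rdp SS) (ε' + εhat) δ := by
  have hα := one_lt_ptrOrder hεhat hδ hδ1
  have main : ∀ rdp SS : (Fin n → Z) → ℝ,
      IsDataDependentRDP (P.noisyLabels σ₁) (ptrOrder εhat δ) rdp →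
      IsSmoothSensitivityBound (ptrBeta εhat δ) rdp SS →
      IsDP (P.ptr σ₁ ε' εhat δ rdp SS) (ε' + εhat) δ ∧
        IsDP (P.ptrTranscript σ₁ ε' εhat δ rdp SS) (ε' + εhat) δ := fun rdp SS h1 h2 =>
    have h := P.isDP_ptrTranscript hε' hεhat hδ hδ1 h1 h2
    ⟨P.isDP_ptr_of_ptrTranscript h, h⟩
  exact ⟨main _ _ (P.isDataDependentRDP_labelRDP hσ₁ hα) (P.isSmoothSensitivityBound_labelSS hα),
    main⟩
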